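/- Let $\mathbb K$ be a field of characteristic $0$; vector spaces, linear maps and tensor products are over $\mathbb K$, and commutative algebras are associative and unital. Let $\mathcal P$ be a symmetric operad over $\mathbb K$ and let $\mathfrak a$ be a finite-dimensional $\mathcal P$-algebra with structure morphism $\gamma:\mathcal P\to \mathrm{End}_{\mathfrak a}$ and basis $a_1,\dots,a_n$. For $\mu\in\mathcal P(k)$ write $\gamma_k(\mu)(a_{i_1},\dots,a_{i_k})=\sum_{s}\alpha^s_{\mu,i_1,\dots,i_k}a_s$. For a commutative algebra $C$, the space $\mathfrak a\otimes C$ is a $\mathcal P$-algebra by $$\mu\,(x_1\otimes c_1,\dots,x_k\otimes c_k)=\gamma_k(\mu)(x_1,\dots,x_k)\otimes c_1\cdots c_k .$$ A coaction of a commutative bialgebra (or Hopf algebra) $H$ on $\mathfrak a$ is a linear map $\psi:\mathfrak a\to\mathfrak a\otimes H$ that is a morphism of $\mathcal P$-algebras and makes $\mathfrak a$ a right $H$-comodule. Let $\mathcal C(\mathfrak a)=\mathbb K[X_{si}\mid 1\le s,i\le n]/J$, where $J$ is the ideal generated by the polynomials $$\sum_{u}\alpha^u_{\mu,i_1,\dots,i_k}X_{su}-\sum_{t_1,\dots,t_k}\alpha^s_{\mu,t_1,\dots,t_k}X_{t_1i_1}\cdots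 X_{t_ki_k}\qquad(k\ge 0,\ \mu\in\mathcal P(k),\ 1\le s,i_1,\dots,i_k\le n),$$ let $x_{si}$ be the class of $X_{si}$, and let $\eta_{\mathfrak a}:\mathfrak a\to\mathfrak a\otimes\mathcal C(\mathfrak a)$ be the linear map $\eta_{\mathfrak a}(a_i)=\sum_s a_s\otimes x_{si}$. Then $\mathcal C(\mathfrak a)$ is a commutative bialgebra with $\Delta(x_{st})=\sum_i x_{si}\otimes x_{it}$ and $\varepsilon(x_{st})=\delta_{st}$. For a commutative bialgebra $B$, let $L(B)$ be the quotient of $B\otimes B$ by the ideal generated by the elements $\sum b_{(1)}\otimes b_{(2)}-\varepsilon(b)1$ and $\sum b_{(2)}\otimes b_{(1)}-\varepsilon(b)1$ with $b\in B$. It is a commutative Hopf algebra whose antipode is induced by the flip of $B\otimes B$, and whose comultiplication and counit make $\mu_B:B\to L(B)$, $b\mapsto [b\otimes 1]$, a map of bialgebras. Put $\mathcal H(\mathfrak a)=L(\mathcal C(\mathfrak a))$ and $\lambda_{\mathfrak a}=(\mathrm{id}\otimes\mu_{\mathcal C(\mathfrak a)})\circ\eta_{\mathfrak a}:\mathfrak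 a\to\mathfrak a\otimes\mathcal H(\mathfrak a)$. **Theorem.** 1. $\mathcal H(\mathfrak a)$ is the free commutative Hopf algebra on $\mathcal C(\mathfrak a)$: for every commutative Hopf algebra $H$ and every bialgebra map $f:\mathcal C(\mathfrak a)\to H$ there is a unique Hopf algebra map $g:\mathcal H(\mathfrak a)\to H$ with $g\circ\mu_{\mathcal C(\mathfrak a)}=f$. 2. $\lambda_{\mathfrak a}$ is a coaction of $\mathcal H(\mathfrak a)$ on $\mathfrak a$. 3. For every commutative Hopf algebra $H$ and every coaction $\psi:\mathfrak a\to\mathfrak a\otimes H$ of $H$ on $\mathfrak a$ there is a unique Hopf algebra map $\Phi:\mathcal H(\mathfrak a)\to H$ with $(\mathrm{id}\otimes\Phi)\circ\lambda_{\mathfrak a}=\psi$. -/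

import Mathlib

open scoped TensorProduct

universe u v w x

namespace OperadCoaction

/-! ### Symmetric operads (partial definition)

The composite `μ ∘_i ν` of `μ ∈ P(m)` and `ν ∈ P(n)` lies in `P(m - 1 + n)`; this arity is written
as any `r` with `r + 1 = m + n`. Inputs are numbered from `0`. -/

section Slots

variable {m n r : ℕ}

/-- The input of `μ ∘_i ν` that is the `j`-th input of `ν`. -/
def innerPos (h : r + 1 = m + n) (i : Fin m) (j : Fin n) : Fin r :=
  ⟨i.1 + j.1, by omega⟩

/-- The input of `μ ∘_i ν` that is the `k`-th input of `μ`, where `k ≠ i`. -/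
def outerPos (h : r + 1 = m + n) (i : Fin m) (k : {k : Fin m // k ≠ i}) : Fin r :=
  ⟨if k.1.1 < i.1 then k.1.1 else k.1.1 + n - 1, by
    have h1 : k.1.1 ≠ i.1 := fun e => k.2 (Fin.ext e)
    split_ifs <;> omega⟩

/-- The inputs of `μ ∘_i ν` are those of `μ` other than `i`, together with those of `ν`. -/
noncomputable def slotEquiv (h : r + 1 = m + n) (i : Fin m) :
    {k : Fin m // k ≠ i} ⊕ Fin n ≃ Fin r :=
  Equiv.ofBijective (Sum.elim (outerPos h i) (innerPos h i)) (by
    constructor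
    · rintro (⟨k, hk⟩ | j) (⟨l, hl⟩ | j2) e
      · have h1 : k.1 ≠ i.1 := fun e => hk (Fin.ext e)
        have h2 : l.1 ≠ i.1 := fun e => hl (Fin.ext e)
        have e2 := congrArg Fin.val e
        simp only [Sum.elim_inl, outerPos] at e2
        have : k = l := Fin.ext (by split_ifs at e2 <;> omega)
        subst this
        rfl
      · exfalso
        have h1 : k.1 ≠ i.1 := fun e => hk (Fin.ext e)
        have e2 := congrArg Fin.val e
        simp only [Sum.elim_inl, Sum.elim_inr, outerPos, innerPos] at e2
        split_ifs at e2 <;> omega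
      · exfalso
        have h1 : l.1 ≠ i.1 := fun e => hl (Fin.ext e)
        have e2 := congrArg Fin.val e
        simp only [Sum.elim_inl, Sum.elim_inr, outerPos, innerPos] at e2
        split_ifs at e2 <;> omega
      · have e2 := congrArg Fin.val e
        simp only [Sum.elim_inr, innerPos] at e2
        have : j = j2 := Fin.ext (by omega)
        rw [this]
    · intro p
      by_cases h1 : p.1 < i.1
      · exact ⟨Sum.inl ⟨⟨p.1, by omega⟩, fun e => by
          have := congrArg Fin.val e; simp at this; omega⟩, Fin.ext (by simp [outerPos, h1])⟩
      · by_cases h2 : p.1 < i.1 + n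
        · exact ⟨Sum.inr ⟨p.1 - i.1, by omega⟩, Fin.ext (by simp [innerPos]; omega)⟩
        · refine ⟨Sum.inl ⟨⟨p.1 + 1 - n, by omega⟩, fun e => by
            have := congrArg Fin.val e; simp at this; omega⟩, Fin.ext ?_⟩
          have h3 : ¬ (p.1 + 1 - n < i.1) := by omega
          simp [outerPos, h3]; omega)

/-- The block permutation `σ ∘_i τ`: the inputs in the block at `i` go to the block at `σ i` as
prescribed by `τ`, and the remaining inputs are permuted as prescribed by `σ`. -/
noncomputable def blockPerm (h : r + 1 = m + n) (i : Fin m)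
    (σ : Equiv.Perm (Fin m)) (τ : Equiv.Perm (Fin n)) : Equiv.Perm (Fin r) :=
  (slotEquiv h i).symm.trans
    ((Equiv.sumCongr (σ.subtypeEquiv fun _ => not_congr σ.injective.eq_iff.symm) τ).trans
      (slotEquiv h (σ i)))

end Slots

/-- A symmetric operad over the field `K`. -/
structure SymmOperad (K : Type u) [Field K] where
  /-- The space of operations of arity `n`. -/
  Op : ℕ → Type v
  [addCommGroup : ∀ n, AddCommGroup (Op n)]
  [module : ∀ n, Module K (Op n)]
  /-- The partial composition `μ ∘_i ν`. -/
  comp : ∀ {m n r : ℕ}, r + 1 = m + n → Fin m → (Op m →ₗ[K] Op n →ₗ[K] Op r)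
  /-- The right action `μ · σ` of the symmetric group. -/
  act : ∀ {n : ℕ}, Equiv.Perm (Fin n) → (Op n →ₗ[K] Op n)
  /-- The unit. -/
  one : Op 1
  act_one : ∀ {n : ℕ} (μ : Op n), act 1 μ = μ
  act_mul : ∀ {n : ℕ} (σ τ : Equiv.Perm (Fin n)) (μ : Op n), act (σ * τ) μ = act τ (act σ μ)
  /-- Associativity, sequential composition: `(μ ∘_i ν) ∘_{i + j} η = μ ∘_i (ν ∘_j η)`. -/
  assoc_seq : ∀ {m n l r s t : ℕ} (h₁ : r + 1 = m + n) (h₂ : s + 1 = r + l) (h₃ : t + 1 = n + l)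
    (h₄ : s + 1 = m + t) (i : Fin m) (j : Fin n) (μ : Op m) (ν : Op n) (η : Op l),
    comp h₂ (innerPos h₁ i j) (comp h₁ i μ ν) η = comp h₄ i μ (comp h₃ j ν η)
  /-- Associativity, parallel composition: inserting `ν` at the input `i` and `η` at the input
  `k ≠ i` of `μ` in either order gives the same result. -/
  assoc_par : ∀ {m n l r s t : ℕ} (h₁ : r + 1 = m + n) (h₂ : s + 1 = r + l) (h₃ : t + 1 = m + l)
    (h₄ : s + 1 = t + n) (i k : Fin m) (hik : i ≠ k) (μ : Op m) (ν : Op n) (η : Op l),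
    comp h₂ (outerPos h₁ i ⟨k, hik.symm⟩) (comp h₁ i μ ν) η =
      comp h₄ (outerPos h₃ k ⟨i, hik⟩) (comp h₃ k μ η) ν
  /-- Equivariance: `(μ · σ) ∘_i (ν · τ) = (μ ∘_{σ i} ν) · (σ ∘_i τ)`. -/
  equivariant : ∀ {m n r : ℕ} (h : r + 1 = m + n) (i : Fin m) (σ : Equiv.Perm (Fin m))
    (τ : Equiv.Perm (Fin n)) (μ : Op m) (ν : Op n),
    comp h i (act σ μ) (act τ ν) = act (blockPerm h i σ τ) (comp h (σ i) μ ν)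
  comp_one : ∀ {n : ℕ} (i : Fin n) (μ : Op n), comp (r := n) rfl i μ one = μ
  one_comp : ∀ {n : ℕ} (μ : Op n), comp (r := n) (Nat.add_comm n 1) 0 one μ = μ

attribute [instance] SymmOperad.addCommGroup SymmOperad.module

/-- A morphism of operads. -/
structure OperadHom {K : Type u} [Field K] (P : SymmOperad.{u, v} K) (Q : SymmOperad.{u, w} K) where
  toFun : ∀ n : ℕ, P.Op n →ₗ[K] Q.Op n
  map_one : toFun 1 P.one = Q.one
  map_comp : ∀ {m n r : ℕ} (h : r + 1 = m + n) (i : Fin m) (μ : P.Op m) (ν : P.Op n),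
    toFun r (P.comp h i μ ν) = Q.comp h i (toFun m μ) (toFun n ν)
  map_act : ∀ {n : ℕ} (σ : Equiv.Perm (Fin n)) (μ : P.Op n),
    toFun n (P.act σ μ) = Q.act σ (toFun n μ)

/-! ### The endomorphism operad -/

section EndOperad

variable {K : Type u} [Field K] {a : Type v} [AddCommGroup a] [Module K a]

set_option linter.unusedSectionVars false

/-- The arguments `(x_1, …, x_{i-1}, g (x_i, …, x_{i+n-1}), x_{i+n}, …)`. -/
def insertArgs {m n r : ℕ} (h : r + 1 = m + n) (i : Fin m) (g : (Fin n → a) → a) (y : Fin r → a) :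
    Fin m → a :=
  fun k => if hk : k = i then g (fun j => y (innerPos h i j)) else y (outerPos h i ⟨k, hk⟩)

@[simp] theorem insertArgs_self {m n r : ℕ} (h : r + 1 = m + n) (i : Fin m)
    (g : (Fin n → a) → a) (y : Fin r → a) :
    insertArgs h i g y i = g (fun j => y (innerPos h i j)) := by
  simp [insertArgs]

theorem insertArgs_ne {m n r : ℕ} (h : r + 1 = m + n) (i : Fin m)
    (g : (Fin n → a) → a) (y : Fin r → a) {k : Fin m} (hk : k ≠ i) :
    insertArgs h i g y k = y (outerPos h i ⟨k, hk⟩) := by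
  simp [insertArgs, hk]

theorem slotEquiv_inl {m n r : ℕ} (h : r + 1 = m + n) (i : Fin m) (k) :
    slotEquiv h i (Sum.inl k) = outerPos h i k := rfl

theorem slotEquiv_inr {m n r : ℕ} (h : r + 1 = m + n) (i : Fin m) (j) :
    slotEquiv h i (Sum.inr j) = innerPos h i j := rfl

theorem insertArgs_update_inner {m n r : ℕ} (h : r + 1 = m + n) (i : Fin m)
    (g : (Fin n → a) → a) (y : Fin r → a) (j : Fin n) (z : a) :
    insertArgs h i g (Function.update y (innerPos h i j) z) =
      Function.update (insertArgs h i g y) i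
        (g (Function.update (fun j => y (innerPos h i j)) j z)) := by
  funext k
  by_cases hk : k = i
  · subst hk
    simp only [insertArgs_self, Function.update_self]
    congr 1
    funext l
    by_cases hl : l = j
    · subst hl; simp
    · rw [Function.update_of_ne hl, Function.update_of_ne]
      intro e
      have := (slotEquiv h k).injective (a₁ := Sum.inr l) (a₂ := Sum.inr j) e
      exact hl (Sum.inr.inj this)
  · rw [Function.update_of_ne hk, insertArgs_ne _ _ _ _ hk, insertArgs_ne _ _ _ _ hk,
      Function.update_of_ne]
    intro e
    have := (slotEquiv h i).injective (a₁ := Sum.inl ⟨k, hk⟩) (a₂ := Sum.inr j) e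
    exact absurd this (by simp)

theorem insertArgs_update_outer {m n r : ℕ} (h : r + 1 = m + n) (i : Fin m)
    (g : (Fin n → a) → a) (y : Fin r → a) (k : {k : Fin m // k ≠ i}) (z : a) :
    insertArgs h i g (Function.update y (outerPos h i k) z) =
      Function.update (insertArgs h i g y) k.1 z := by
  funext l
  by_cases hl : l = i
  · subst hl
    rw [Function.update_of_ne k.2.symm]
    simp only [insertArgs_self]
    congr 1
    funext j
    rw [Function.update_of_ne]
    intro e
    have := (slotEquiv h l).injective (a₁ := Sum.inr j) (a₂ := Sum.inl k) e
    exact absurd this (by simp)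
  · rw [insertArgs_ne _ _ _ _ hl]
    by_cases hlk : l = k.1
    · subst hlk
      simp
    · rw [Function.update_of_ne hlk, insertArgs_ne _ _ _ _ hl, Function.update_of_ne]
      intro e
      have := (slotEquiv h i).injective (a₁ := Sum.inl ⟨l, hl⟩) (a₂ := Sum.inl k) e
      exact hlk (congrArg Subtype.val (Sum.inl.inj this))

/-- Partial composition of multilinear maps:
`(f ∘_i g)(x_1, …) = f (x_1, …, x_{i-1}, g (x_i, …, x_{i+n-1}), x_{i+n}, …)`. -/
def endComp {m n r : ℕ} (h : r + 1 = m + n) (i : Fin m)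
    (f : MultilinearMap K (fun _ : Fin m => a) a) (g : MultilinearMap K (fun _ : Fin n => a) a) :
    MultilinearMap K (fun _ : Fin r => a) a :=
  MultilinearMap.mk' (fun y => f (insertArgs h i g y))
    (by
      intro y p z z2
      obtain ⟨q, rfl⟩ := (slotEquiv h i).surjective p
      rcases q with k | j
      · simp only [slotEquiv_inl, insertArgs_update_outer, MultilinearMap.map_update_add]
      · simp only [slotEquiv_inr, insertArgs_update_inner, MultilinearMap.map_update_add])
    (by
      intro y p c z
      obtain ⟨q, rfl⟩ := (slotEquiv h i).surjective p
      rcases q with k | j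
      · simp only [slotEquiv_inl, insertArgs_update_outer, MultilinearMap.map_update_smul]
      · simp only [slotEquiv_inr, insertArgs_update_inner, MultilinearMap.map_update_smul])

@[simp] theorem endComp_apply {m n r : ℕ} (h : r + 1 = m + n) (i : Fin m)
    (f : MultilinearMap K (fun _ : Fin m => a) a) (g : MultilinearMap K (fun _ : Fin n => a) a)
    (y : Fin r → a) : endComp h i f g y = f (insertArgs h i g y) := rfl

theorem insertArgs_eq_update {m n r : ℕ} (h : r + 1 = m + n) (i : Fin m)
    (g : (Fin n → a) → a) (y : Fin r → a) :
    insertArgs h i g y =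
      Function.update (insertArgs h i (fun _ => 0) y) i (g (fun j => y (innerPos h i j))) := by
  funext k
  by_cases hk : k = i
  · subst hk; simp
  · rw [Function.update_of_ne hk, insertArgs_ne _ _ _ _ hk, insertArgs_ne _ _ _ _ hk]

theorem blockPerm_inner {m n r : ℕ} (h : r + 1 = m + n) (i : Fin m)
    (σ : Equiv.Perm (Fin m)) (τ : Equiv.Perm (Fin n)) (j : Fin n) :
    blockPerm h i σ τ (innerPos h i j) = innerPos h (σ i) (τ j) := by
  rw [← slotEquiv_inr, ← slotEquiv_inr]
  simp [blockPerm]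

theorem blockPerm_outer {m n r : ℕ} (h : r + 1 = m + n) (i : Fin m)
    (σ : Equiv.Perm (Fin m)) (τ : Equiv.Perm (Fin n)) (k : {k : Fin m // k ≠ i}) :
    blockPerm h i σ τ (outerPos h i k) =
      outerPos h (σ i) ⟨σ k.1, fun e => k.2 (σ.injective e)⟩ := by
  rw [← slotEquiv_inl, ← slotEquiv_inl]
  simp [blockPerm]

variable (K a) in
/-- The endomorphism operad of `a`: `End_a(n)` consists of the `n`-linear maps `a × ⋯ × a → a`,
and `(f · σ)(x_1, …, x_n) = f (x_{σ⁻¹(1)}, …, x_{σ⁻¹(n)})`. -/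
def endOperad : SymmOperad K where
  Op n := MultilinearMap K (fun _ : Fin n => a) a
  comp h i := LinearMap.mk₂ K (endComp h i)
    (fun f f2 g => by ext y; simp)
    (fun c f g => by ext y; simp)
    (fun f g g2 => by
      ext y
      simp only [endComp_apply, add_apply]
      rw [insertArgs_eq_update, add_apply, MultilinearMap.map_update_add,
        ← insertArgs_eq_update, ← insertArgs_eq_update])
    (fun c f g => by
      ext y
      simp only [endComp_apply, smul_apply]
      rw [insertArgs_eq_update, smul_apply, MultilinearMap.map_update_smul,
        ← insertArgs_eq_update])
  act σ := (MultilinearMap.domDomCongrLinearEquiv K K a a σ.symm).toLinearMap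
  one := MultilinearMap.ofSubsingleton K a a (0 : Fin 1) LinearMap.id
  act_one f := by ext y; simp; rfl
  act_mul σ τ f := by ext y; simp; rfl
  assoc_seq h₁ h₂ h₃ h₄ i j f g e := by
    ext y
    simp only [LinearMap.mk₂_apply, endComp_apply]
    congr 1
    funext k
    by_cases hk : k = i
    · subst hk
      simp only [insertArgs_self, endComp_apply]
      congr 1
      funext l
      by_cases hl : l = j
      · subst hl
        simp only [insertArgs_self]
        congr 1
        funext p
        congr 1
        exact Fin.ext (by simp [innerPos]; omega)
      · have hl2 : l.1 ≠ j.1 := fun e => hl (Fin.ext e)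
        have hne : innerPos h₁ k l ≠ innerPos h₁ k j := fun e => hl2 (by
          have := congrArg Fin.val e; simp [innerPos] at this; omega)
        rw [insertArgs_ne _ _ _ _ hl, insertArgs_ne _ _ _ _ hne]
        congr 1
        apply Fin.ext
        rcases lt_or_gt_of_ne hl2 with H | H
        · simp [innerPos, outerPos, H]
        · have H2 : ¬ (l.1 < j.1) := by omega
          simp [innerPos, outerPos, H2]
          omega
    · have hk2 : k.1 ≠ i.1 := fun e => hk (Fin.ext e)
      have hne : outerPos h₁ i ⟨k, hk⟩ ≠ innerPos h₁ i j := fun e => by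
        have := congrArg Fin.val e; simp only [innerPos, outerPos] at this
        split_ifs at this <;> omega
      rw [insertArgs_ne _ _ _ _ hk, insertArgs_ne _ _ _ _ hk, insertArgs_ne _ _ _ _ hne]
      congr 1
      apply Fin.ext
      simp only [innerPos, outerPos]
      split_ifs <;> omega
  assoc_par h₁ h₂ h₃ h₄ i k hik f g e := by
    ext y
    simp only [LinearMap.mk₂_apply, endComp_apply]
    have hik2 : i.1 ≠ k.1 := fun e => hik (Fin.ext e)
    congr 1
    funext l
    by_cases hli : l = i
    · subst hli
      rw [insertArgs_ne _ _ _ _ hik]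
      simp only [insertArgs_self]
      congr 1
      funext j
      have hne : innerPos h₁ l j ≠ outerPos h₁ l ⟨k, hik.symm⟩ := fun e => by
        have := congrArg Fin.val e; simp only [innerPos, outerPos] at this
        split_ifs at this <;> omega
      rw [insertArgs_ne _ _ _ _ hne]
      congr 1
      apply Fin.ext
      simp only [innerPos, outerPos]
      split_ifs <;> omega
    · by_cases hlk : l = k
      · subst hlk
        rw [insertArgs_ne _ _ _ _ hli]
        simp only [insertArgs_self]
        congr 1
        funext j
        have hne : innerPos h₃ l j ≠ outerPos h₃ l ⟨i, hik⟩ := fun e => by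
          have := congrArg Fin.val e; simp only [innerPos, outerPos] at this
          split_ifs at this <;> omega
        rw [insertArgs_ne _ _ _ _ hne]
        congr 1
        apply Fin.ext
        simp only [innerPos, outerPos]
        split_ifs <;> omega
      · have h5 : l.1 ≠ i.1 := fun e => hli (Fin.ext e)
        have h6 : l.1 ≠ k.1 := fun e => hlk (Fin.ext e)
        have hne1 : outerPos h₁ i ⟨l, hli⟩ ≠ outerPos h₁ i ⟨k, hik.symm⟩ := fun e => by
          have := congrArg Fin.val e; simp only [outerPos] at this
          split_ifs at this <;> omega
        have hne2 : outerPos h₃ k ⟨l, hlk⟩ ≠ outerPos h₃ k ⟨i, hik⟩ := fun e => by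
          have := congrArg Fin.val e; simp only [outerPos] at this
          split_ifs at this <;> omega
        rw [insertArgs_ne _ _ _ _ hli, insertArgs_ne _ _ _ _ hlk, insertArgs_ne _ _ _ _ hne1,
          insertArgs_ne _ _ _ _ hne2]
        congr 1
        apply Fin.ext
        simp only [outerPos]
        split_ifs <;> omega
  equivariant h i σ τ f g := by
    ext y
    change f (fun k => insertArgs h i (fun z => g (fun j => z (τ.symm j))) y (σ.symm k)) =
      f (insertArgs h (σ i) g (fun p => y ((blockPerm h i σ τ).symm p)))
    congr 1
    funext k
    obtain ⟨k, rfl⟩ := σ.surjective k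
    rw [Equiv.symm_apply_apply]
    by_cases hk : k = i
    · subst hk
      simp only [insertArgs_self]
      congr 1
      funext j
      obtain ⟨j, rfl⟩ := τ.surjective j
      rw [Equiv.symm_apply_apply, ← blockPerm_inner, Equiv.symm_apply_apply]
    · have hk2 : σ k ≠ σ i := fun e => hk (σ.injective e)
      rw [insertArgs_ne _ _ _ _ hk, insertArgs_ne _ _ _ _ hk2, ← blockPerm_outer h i σ τ ⟨k, hk⟩,
        Equiv.symm_apply_apply]
  comp_one i f := by
    ext y
    simp only [LinearMap.mk₂_apply, endComp_apply]
    congr 1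
    funext k
    by_cases hk : k = i
    · subst hk
      simp only [insertArgs_self, MultilinearMap.ofSubsingleton_apply_apply, LinearMap.id_apply]
      congr 1
    · have hk2 : k.1 ≠ i.1 := fun e => hk (Fin.ext e)
      rw [insertArgs_ne _ _ _ _ hk]
      congr 1
      apply Fin.ext
      simp only [outerPos]
      split_ifs <;> omega
  one_comp f := by
    ext y
    simp only [LinearMap.mk₂_apply, endComp_apply, MultilinearMap.ofSubsingleton_apply_apply,
      LinearMap.id_apply, insertArgs_self]
    congr 1
    funext j
    congr 1
    exact Fin.ext (by simp [innerPos])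

/-- A `P`-algebra structure on the vector space `a`: a morphism of operads `P → End_a`. -/
abbrev OperadAlgebra (P : SymmOperad.{u, w} K) (a : Type v) [AddCommGroup a] [Module K a] :=
  OperadHom P (endOperad K a)

/-- The `n`-ary operation `γ_n(μ)` on `a` given by `μ ∈ P(n)`, linear in `μ`. -/
def OperadHom.operation {P : SymmOperad.{u, w} K} (γ : OperadAlgebra P a) {n : ℕ} :
    P.Op n →ₗ[K] MultilinearMap K (fun _ : Fin n => a) a :=
  γ.toFun n

theorem operation_one {P : SymmOperad.{u, w} K} (γ : OperadAlgebra P a) (y : Fin 1 → a) :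
    γ.operation P.one y = y 0 :=
  congrArg (fun f : MultilinearMap K (fun _ : Fin 1 => a) a => f y) γ.map_one

theorem operation_comp {P : SymmOperad.{u, w} K} (γ : OperadAlgebra P a) {m n r : ℕ}
    (h : r + 1 = m + n) (i : Fin m) (μ : P.Op m) (ν : P.Op n) (y : Fin r → a) :
    γ.operation (P.comp h i μ ν) y = γ.operation μ (insertArgs h i (γ.operation ν) y) :=
  congrArg (fun f : MultilinearMap K (fun _ : Fin r => a) a => f y) (γ.map_comp h i μ ν)

theorem operation_act {P : SymmOperad.{u, w} K} (γ : OperadAlgebra P a) {n : ℕ}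
    (σ : Equiv.Perm (Fin n)) (μ : P.Op n) (y : Fin n → a) :
    γ.operation (P.act σ μ) y = γ.operation μ (fun i => y (σ.symm i)) :=
  congrArg (fun f : MultilinearMap K (fun _ : Fin n => a) a => f y) (γ.map_act σ μ)

/-- A `P`-algebra structure given by its operations. -/
def OperadAlgebra.ofOperations {P : SymmOperad.{u, w} K}
    (op : ∀ n : ℕ, P.Op n →ₗ[K] MultilinearMap K (fun _ : Fin n => a) a)
    (h_one : ∀ y, op 1 P.one y = y 0)
    (h_comp : ∀ {m n r : ℕ} (h : r + 1 = m + n) (i : Fin m) (μ : P.Op m) (ν : P.Op n)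
      (y : Fin r → a), op r (P.comp h i μ ν) y = op m μ (insertArgs h i (op n ν) y))
    (h_act : ∀ {n : ℕ} (σ : Equiv.Perm (Fin n)) (μ : P.Op n) (y : Fin n → a),
      op n (P.act σ μ) y = op n μ (fun i => y (σ.symm i))) :
    OperadAlgebra P a where
  toFun := op
  map_one := MultilinearMap.ext h_one
  map_comp h i μ ν := MultilinearMap.ext (h_comp h i μ ν)
  map_act σ μ := MultilinearMap.ext (h_act σ μ)

/-- `f : a → b` is a morphism of `P`-algebras. -/
def IsAlgebraHom {P : SymmOperad.{u, w} K} {b : Type x} [AddCommGroup b] [Module K b]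
    (γ : OperadAlgebra P a) (γb : OperadAlgebra P b) (f : a →ₗ[K] b) : Prop :=
  ∀ (n : ℕ) (μ : P.Op n) (y : Fin n → a),
    f (γ.operation μ y) = γb.operation μ (fun i => f (y i))

end EndOperad

/-! ### The `P`-algebra `a ⊗ C` for a commutative algebra `C` -/

section TensorAlgebraStructure

variable {K : Type u} [Field K] {a : Type v} [AddCommGroup a] [Module K a]
variable {C : Type x} [CommRing C] [Algebra K C]

/-- The multilinear map on `a ⊗ C` with
`(a_1 ⊗ c_1, …, a_n ⊗ c_n) ↦ f (a_1, …, a_n) ⊗ c_1 ⋯ c_n` (see `tensorOp_tmul`), obtained from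
the multiplication of `T(a) ⊗ C`, where `T(a)` is the tensor algebra. -/
noncomputable def tensorOp {n : ℕ} (f : MultilinearMap K (fun _ : Fin n => a) a) :
    MultilinearMap K (fun _ : Fin n => a ⊗[K] C) (a ⊗[K] C) :=
  (TensorProduct.map (PiTensorProduct.lift f ∘ₗ
      DirectSum.component K ℕ (fun k => ⨂[K]^k a) n ∘ₗ
      (TensorAlgebra.toDirectSum (R := K) (M := a)).toLinearMap)
    (LinearMap.id : C →ₗ[K] C)).compMultilinearMap
  ((MultilinearMap.mkPiAlgebraFin K n (TensorAlgebra K a ⊗[K] C)).compLinearMap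
    (fun _ => TensorProduct.map (TensorAlgebra.ι K) LinearMap.id))

theorem list_prod_ofFn_tmul {n : ℕ} (y : Fin n → TensorAlgebra K a) (c : Fin n → C) :
    (List.ofFn fun i => y i ⊗ₜ[K] c i).prod = (List.ofFn y).prod ⊗ₜ[K] (List.ofFn c).prod := by
  induction n with
  | zero => simp [Algebra.TensorProduct.one_def]
  | succ n ih => simp [List.ofFn_succ, ih, Algebra.TensorProduct.tmul_mul_tmul]

theorem tensorOp_tmul {n : ℕ} (f : MultilinearMap K (fun _ : Fin n => a) a)
    (y : Fin n → a) (c : Fin n → C) :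
    tensorOp f (fun i => y i ⊗ₜ[K] c i) = f y ⊗ₜ[K] ∏ i, c i := by
  have h : (List.ofFn fun i => TensorAlgebra.ι K (y i)).prod = TensorAlgebra.tprod K a n y :=
    by
    simp [TensorAlgebra.tprod_apply]
  simp only [tensorOp, LinearMap.compMultilinearMap_apply, MultilinearMap.compLinearMap_apply,
    MultilinearMap.mkPiAlgebraFin_apply, TensorProduct.map_tmul, LinearMap.id_apply,
    list_prod_ofFn_tmul, h, List.prod_ofFn, LinearMap.comp_apply, AlgHom.toLinearMap_apply]
  rw [TensorAlgebra.toDirectSum_tensorPower_tprod, ← DirectSum.lof_eq_of K,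
    DirectSum.component.lof_self, PiTensorProduct.lift.tprod]

theorem multilinear_ext_tmul {n : ℕ} {E : Type*} [AddCommGroup E] [Module K E]
    {f g : MultilinearMap K (fun _ : Fin n => a ⊗[K] C) E}
    (h : ∀ (y : Fin n → a) (c : Fin n → C),
      f (fun i => y i ⊗ₜ[K] c i) = g (fun i => y i ⊗ₜ[K] c i)) : f = g := by
  refine Module.Basis.ext_multilinear (fun _ : Fin n =>
    (Module.Basis.ofVectorSpace K a).tensorProduct (Module.Basis.ofVectorSpace K C)) fun v => ?_
  have e : (fun i : Fin n => ((Module.Basis.ofVectorSpace K a).tensorProduct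
      (Module.Basis.ofVectorSpace K C)) (v i)) = fun i => (Module.Basis.ofVectorSpace K a (v i).1)
        ⊗ₜ[K] (Module.Basis.ofVectorSpace K C (v i).2) :=
    funext fun i => Module.Basis.tensorProduct_apply' _ _ _
  rw [e]
  exact h _ _

theorem prod_insertArgs {m n r : ℕ} (h : r + 1 = m + n) (i : Fin m) (c : Fin r → C) :
    ∏ k, insertArgs h i (fun z : Fin n → C => ∏ j, z j) c k = ∏ p, c p := by
  rw [← (slotEquiv h i).prod_comp, Fintype.prod_sum_type, Fintype.prod_eq_mul_prod_subtype_ne _ i,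
    insertArgs_self, mul_comm]
  congr 1
  exact Finset.prod_congr rfl fun k _ => insertArgs_ne h i _ c k.2

theorem insertArgs_tmul {m n r : ℕ} (h : r + 1 = m + n) (i : Fin m)
    (g : MultilinearMap K (fun _ : Fin n => a) a) (y : Fin r → a) (c : Fin r → C) :
    insertArgs h i (tensorOp g) (fun p => y p ⊗ₜ[K] c p) =
      fun k => insertArgs h i g y k ⊗ₜ[K] insertArgs h i (fun z : Fin n → C => ∏ j, z j) c k := by
  funext k
  by_cases hk : k = i
  · subst hk
    simp only [insertArgs_self, tensorOp_tmul]
  · simp only [insertArgs_ne _ _ _ _ hk]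

variable (C) in
/-- `tensorOp` is linear in the multilinear map. -/
noncomputable def tensorOpLinear (n : ℕ) : MultilinearMap K (fun _ : Fin n => a) a →ₗ[K]
    MultilinearMap K (fun _ : Fin n => a ⊗[K] C) (a ⊗[K] C) where
  toFun := tensorOp
  map_add' f g := multilinear_ext_tmul fun y c => by
    simp only [add_apply, tensorOp_tmul, TensorProduct.add_tmul]
  map_smul' t f := multilinear_ext_tmul fun y c => by
    simp only [smul_apply, tensorOp_tmul, TensorProduct.smul_tmul', RingHom.id_apply]

variable (C) in
/-- The `P`-algebra structure on `a ⊗ C` induced by that of `a`: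
`γ_n(μ)(a_1 ⊗ c_1, …, a_n ⊗ c_n) = γ_n(μ)(a_1, …, a_n) ⊗ c_1 ⋯ c_n`. -/
noncomputable def tensorStructure {P : SymmOperad.{u, w} K} (γ : OperadAlgebra P a) :
    OperadAlgebra P (a ⊗[K] C) :=
  OperadAlgebra.ofOperations (fun n => tensorOpLinear C n ∘ₗ γ.operation)
    (fun y => by
      have h : tensorOp (γ.operation P.one) =
          MultilinearMap.ofSubsingleton K (a ⊗[K] C) (a ⊗[K] C) (0 : Fin 1) LinearMap.id :=
        multilinear_ext_tmul fun y c => by simp [tensorOp_tmul, operation_one]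
      exact congrArg (fun f => f y) h)
    (fun {m n r} h i μ ν y => by
      have h : tensorOp (γ.operation (P.comp h i μ ν)) =
          endComp h i (tensorOp (C := C) (γ.operation μ)) (tensorOp (γ.operation ν)) :=
        multilinear_ext_tmul fun y c => by
          rw [endComp_apply, insertArgs_tmul, tensorOp_tmul, tensorOp_tmul, prod_insertArgs,
            operation_comp]
      exact congrArg (fun f => f y) h)
    (fun {n} σ μ y => by
      have h : tensorOp (γ.operation (P.act σ μ)) =
          (tensorOp (C := C) (γ.operation μ)).domDomCongr σ.symm :=
        multilinear_ext_tmul fun y c => by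
          rw [MultilinearMap.domDomCongr_apply, tensorOp_tmul, tensorOp_tmul, operation_act,
            Equiv.prod_comp σ.symm c]
      exact congrArg (fun f => f y) h)

theorem tensorStructure_operation_tmul {P : SymmOperad.{u, w} K} (γ : OperadAlgebra P a) {n : ℕ}
    (μ : P.Op n) (y : Fin n → a) (c : Fin n → C) :
    (tensorStructure C γ).operation μ (fun i => y i ⊗ₜ[K] c i) =
      γ.operation μ y ⊗ₜ[K] ∏ i, c i :=
  tensorOp_tmul _ y c

end TensorAlgebraStructure

/-! ### Coactions -/

/-- The linear map `ψ : a → a ⊗ H` is a coaction of the commutative bialgebra `H` on the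
`P`-algebra `a`: it is a morphism of `P`-algebras and a right `H`-comodule structure on `a`. -/
structure IsCoaction {K : Type u} [Field K] {P : SymmOperad.{u, w} K} {a : Type v}
    [AddCommGroup a] [Module K a] (γ : OperadAlgebra P a) {H : Type x} [CommRing H]
    [Bialgebra K H] (ψ : a →ₗ[K] a ⊗[K] H) : Prop where
  isAlgebraHom : IsAlgebraHom γ (tensorStructure H γ) ψ
  coassoc : (Coalgebra.comul (R := K) (A := H)).lTensor a ∘ₗ ψ =
    (TensorProduct.assoc K a H H).toLinearMap ∘ₗ ψ.rTensor H ∘ₗ ψ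
  counit : (Coalgebra.counit (R := K) (A := H)).lTensor a ∘ₗ ψ =
    (TensorProduct.rid K a).symm.toLinearMap

/-! ### The universal algebra `C(a)` -/

section UniversalAlgebra

variable {K : Type u} [Field K] {P : SymmOperad.{u, w} K} {a : Type v} [AddCommGroup a]
  [Module K a] {n : ℕ}

/-- The structure constants `α^s_{μ, i_1, …, i_k}` of `a` in the basis `b`:
`γ_k(μ)(b_{i_1}, …, b_{i_k}) = ∑_s α^s_{μ, i_1, …, i_k} b_s`. -/
noncomputable def structConst (γ : OperadAlgebra P a) (b : Module.Basis (Fin n) K a) {k : ℕ}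
    (μ : P.Op k) (i : Fin k → Fin n) (s : Fin n) : K :=
  b.repr (γ.operation μ (fun j => b (i j))) s

/-- The universal polynomials
`∑_u α^u_{μ, i_1, …, i_k} X_{su} - ∑_{t_1, …, t_k} α^s_{μ, t_1, …, t_k} X_{t_1 i_1} ⋯ X_{t_k i_k}`
of `a`. -/
noncomputable def universalPoly (γ : OperadAlgebra P a) (b : Module.Basis (Fin n) K a) {k : ℕ}
    (μ : P.Op k) (i : Fin k → Fin n) (s : Fin n) : MvPolynomial (Fin n × Fin n) K :=
  ∑ u, MvPolynomial.C (structConst γ b μ i u) * MvPolynomial.X (s, u) -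
    ∑ t : Fin k → Fin n, MvPolynomial.C (structConst γ b μ t s) *
      ∏ j, MvPolynomial.X (t j, i j)

/-- The ideal generated by the universal polynomials. -/
noncomputable def universalIdeal (γ : OperadAlgebra P a) (b : Module.Basis (Fin n) K a) :
    Ideal (MvPolynomial (Fin n × Fin n) K) :=
  Ideal.span {p | ∃ (k : ℕ) (μ : P.Op k) (i : Fin k → Fin n) (s : Fin n),
    p = universalPoly γ b μ i s}

/-- The universal algebra `C(a) = K[X_{si}] / J` of `a`, where `b` is a basis of `a`. -/
def UniversalAlgebra (γ : OperadAlgebra P a) (b : Module.Basis (Fin n) K a) : Type u :=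
  MvPolynomial (Fin n × Fin n) K ⧸ universalIdeal γ b

noncomputable instance (γ : OperadAlgebra P a) (b : Module.Basis (Fin n) K a) :
    CommRing (UniversalAlgebra γ b) :=
  inferInstanceAs (CommRing (MvPolynomial (Fin n × Fin n) K ⧸ universalIdeal γ b))

noncomputable instance (γ : OperadAlgebra P a) (b : Module.Basis (Fin n) K a) :
    Algebra K (UniversalAlgebra γ b) :=
  inferInstanceAs (Algebra K (MvPolynomial (Fin n × Fin n) K ⧸ universalIdeal γ b))

namespace UniversalAlgebra

variable (γ : OperadAlgebra P a) (b : Module.Basis (Fin n) K a)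

/-- The quotient map `K[X_{si}] → C(a)`. -/
noncomputable def mkHom : MvPolynomial (Fin n × Fin n) K →ₐ[K] UniversalAlgebra γ b :=
  Ideal.Quotient.mkₐ K (universalIdeal γ b)

/-- The class `x_{si}` of `X_{si}`. -/
noncomputable def gen (s i : Fin n) : UniversalAlgebra γ b :=
  mkHom γ b (MvPolynomial.X (s, i))

theorem mkHom_surjective : Function.Surjective (mkHom γ b) :=
  Ideal.Quotient.mkₐ_surjective K (universalIdeal γ b)

variable {γ b} in
theorem hom_ext {A : Type*} [CommRing A] [Algebra K A] {f g : UniversalAlgebra γ b →ₐ[K] A}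
    (h : ∀ s i, f (gen γ b s i) = g (gen γ b s i)) : f = g := by
  have h2 : f.comp (mkHom γ b) = g.comp (mkHom γ b) :=
    MvPolynomial.algHom_ext fun p => h p.1 p.2
  refine AlgHom.ext fun y => ?_
  obtain ⟨p, rfl⟩ := mkHom_surjective γ b y
  exact AlgHom.congr_fun h2 p

/-- The relations satisfied by the entries of the matrix `c` that are imposed on `(x_{si})`. -/
def Relations {A : Type*} [CommRing A] [Algebra K A] (c : Fin n → Fin n → A) : Prop :=
  ∀ (k : ℕ) (μ : P.Op k) (i : Fin k → Fin n) (s : Fin n),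
    ∑ u, algebraMap K A (structConst γ b μ i u) * c s u =
      ∑ t : Fin k → Fin n, algebraMap K A (structConst γ b μ t s) * ∏ j, c (t j) (i j)

theorem relations_gen : Relations γ b (gen γ b) := by
  intro k μ i s
  have h : mkHom γ b (universalPoly γ b μ i s) = 0 :=
    Ideal.Quotient.eq_zero_iff_mem.mpr (Ideal.subset_span ⟨k, μ, i, s, rfl⟩)
  rw [universalPoly, map_sub, sub_eq_zero] at h
  simp only [map_sum, map_mul, map_prod, ← MvPolynomial.algebraMap_eq, AlgHom.commutes] at h
  exact h

variable {γ b} in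
/-- The algebra map `C(a) → A` with `x_{si} ↦ c_{si}`. -/
noncomputable def liftHom {A : Type*} [CommRing A] [Algebra K A] (c : Fin n → Fin n → A)
    (hc : Relations γ b c) : UniversalAlgebra γ b →ₐ[K] A :=
  Ideal.Quotient.liftₐ (universalIdeal γ b) (MvPolynomial.aeval fun p => c p.1 p.2) (by
    intro p hp
    have h2 : universalIdeal γ b ≤ RingHom.ker
        (MvPolynomial.aeval (R := K) fun p : Fin n × Fin n => c p.1 p.2) := by
      refine Ideal.span_le.mpr ?_
      rintro _ ⟨k, μ, i, s, rfl⟩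
      have := hc k μ i s
      simp only [SetLike.mem_coe, RingHom.mem_ker, universalPoly, map_sub, map_sum, map_mul,
        map_prod, MvPolynomial.aeval_C, MvPolynomial.aeval_X, this, sub_self]
    exact h2 hp)

@[simp] theorem liftHom_gen {A : Type*} [CommRing A] [Algebra K A] (c : Fin n → Fin n → A)
    (hc : Relations γ b c) (s i : Fin n) : liftHom c hc (gen γ b s i) = c s i := by
  have : liftHom c hc (gen γ b s i) =
      MvPolynomial.aeval (R := K) (fun p : Fin n × Fin n => c p.1 p.2) (MvPolynomial.X (s, i)) :=
    rfl
  rw [this, MvPolynomial.aeval_X]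

theorem Relations.map {A B : Type*} [CommRing A] [Algebra K A] [CommRing B] [Algebra K B]
    {c : Fin n → Fin n → A} (hc : Relations γ b c) (f : A →ₐ[K] B) :
    Relations γ b (fun s i => f (c s i)) := by
  intro k μ i s
  have := congrArg f (hc k μ i s)
  simpa only [map_sum, map_mul, map_prod, AlgHom.commutes] using this

theorem Relations.mul {A : Type*} [CommRing A] [Algebra K A] {c d : Fin n → Fin n → A}
    (hc : Relations γ b c) (hd : Relations γ b d) :
    Relations γ b (fun s i => ∑ v, c s v * d v i) := by
  intro k μ i s
  calc ∑ u, algebraMap K A (structConst γ b μ i u) * ∑ v, c s v * d v u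
      = ∑ v, c s v * ∑ u, algebraMap K A (structConst γ b μ i u) * d v u := by
        simp only [Finset.mul_sum]
        rw [Finset.sum_comm]
        exact Finset.sum_congr rfl fun v _ => Finset.sum_congr rfl fun u _ => by ring
    _ = ∑ v, c s v * ∑ t : Fin k → Fin n,
          algebraMap K A (structConst γ b μ t v) * ∏ j, d (t j) (i j) := by
        exact Finset.sum_congr rfl fun v _ => by rw [hd]
    _ = ∑ t : Fin k → Fin n, (∑ v, algebraMap K A (structConst γ b μ t v) * c s v) *
          ∏ j, d (t j) (i j) := by
        simp only [Finset.mul_sum, Finset.sum_mul]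
        rw [Finset.sum_comm]
        exact Finset.sum_congr rfl fun v _ => Finset.sum_congr rfl fun u _ => by ring
    _ = ∑ t : Fin k → Fin n, (∑ q : Fin k → Fin n, algebraMap K A (structConst γ b μ q s) *
          ∏ j, c (q j) (t j)) * ∏ j, d (t j) (i j) := by
        exact Finset.sum_congr rfl fun t _ => by rw [hc]
    _ = ∑ q : Fin k → Fin n, algebraMap K A (structConst γ b μ q s) *
          ∑ t : Fin k → Fin n, ∏ j, c (q j) (t j) * d (t j) (i j) := by
        simp only [Finset.mul_sum, Finset.sum_mul, Finset.prod_mul_distrib]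
        rw [Finset.sum_comm]
        exact Finset.sum_congr rfl fun v _ => Finset.sum_congr rfl fun u _ => by ring
    _ = _ := by
        refine Finset.sum_congr rfl fun q _ => ?_
        rw [Finset.prod_univ_sum, Fintype.piFinset_univ]

theorem relations_one : Relations γ b (fun s i : Fin n => if s = i then (1 : K) else 0) := by
  intro k μ i s
  rw [Finset.sum_eq_single s, Finset.sum_eq_single i]
  · simp
  · intro t _ ht
    obtain ⟨j, hj⟩ := Function.ne_iff.mp ht
    rw [Finset.prod_eq_zero (Finset.mem_univ j) (by simp [hj]), mul_zero]
  · simp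
  · intro u _ hu
    simp [hu.symm]
  · simp

/-- The comultiplication `Δ(x_{st}) = ∑_i x_{si} ⊗ x_{it}`. -/
noncomputable def comulHom :
    UniversalAlgebra γ b →ₐ[K] UniversalAlgebra γ b ⊗[K] UniversalAlgebra γ b :=
  liftHom (fun s t => ∑ i, gen γ b s i ⊗ₜ[K] gen γ b i t) (by
    have h := ((relations_gen γ b).map γ b (Algebra.TensorProduct.includeLeft :
        UniversalAlgebra γ b →ₐ[K] UniversalAlgebra γ b ⊗[K] UniversalAlgebra γ b)).mul γ b
      ((relations_gen γ b).map γ b (Algebra.TensorProduct.includeRight :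
        UniversalAlgebra γ b →ₐ[K] UniversalAlgebra γ b ⊗[K] UniversalAlgebra γ b))
    simpa using h)

/-- The counit `ε(x_{st}) = δ_{st}`. -/
noncomputable def counitHom : UniversalAlgebra γ b →ₐ[K] K :=
  liftHom (fun s t => if s = t then 1 else 0) (relations_one γ b)

noncomputable instance : Bialgebra K (UniversalAlgebra γ b) :=
  Bialgebra.ofAlgHom (comulHom γ b) (counitHom γ b)
    (hom_ext fun s t => by
      simp only [comulHom, AlgHom.comp_apply, liftHom_gen, map_sum,
        Algebra.TensorProduct.map_tmul, AlgHom.id_apply, TensorProduct.sum_tmul,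
        TensorProduct.tmul_sum]
      exact Finset.sum_comm)
    (hom_ext fun s t => by
      simp [comulHom, counitHom, TensorProduct.ite_tmul])
    (hom_ext fun s t => by
      simp [comulHom, counitHom, TensorProduct.tmul_ite])

/-- The canonical map `η_a : a → a ⊗ C(a)`, `η_a(b_i) = ∑_s b_s ⊗ x_{si}`. -/
noncomputable def eta : a →ₗ[K] a ⊗[K] UniversalAlgebra γ b :=
  b.constr K fun i => ∑ s, b s ⊗ₜ[K] gen γ b s i

end UniversalAlgebra

end UniversalAlgebra

/-! ### The free commutative Hopf algebra on a commutative bialgebra -/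

section FreeCommHopf

variable (K : Type u) [Field K] (B : Type v) [CommRing B] [Bialgebra K B]

/-- The ideal of `B ⊗ B` generated by the elements `∑ b₁ ⊗ b₂ - ε(b)` and `∑ b₂ ⊗ b₁ - ε(b)`. -/
def freeCommHopfIdeal : Ideal (B ⊗[K] B) :=
  Ideal.span ({z | ∃ y : B, z = Coalgebra.comul (R := K) y -
      algebraMap K (B ⊗[K] B) (Coalgebra.counit y)} ∪
    {z | ∃ y : B, z = TensorProduct.comm K B B (Coalgebra.comul (R := K) y) -
      algebraMap K (B ⊗[K] B) (Coalgebra.counit y)})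

/-- The free commutative Hopf algebra `L(B)` on the commutative bialgebra `B`: the commutative
algebra generated by the algebra `B` and a second copy `{S b | b ∈ B}` of it, subject to
`∑ b₁ S(b₂) = ε(b) = ∑ S(b₁) b₂`. -/
def FreeCommHopf : Type v := (B ⊗[K] B) ⧸ freeCommHopfIdeal K B

noncomputable instance : CommRing (FreeCommHopf K B) :=
  inferInstanceAs (CommRing ((B ⊗[K] B) ⧸ freeCommHopfIdeal K B))

noncomputable instance : Algebra K (FreeCommHopf K B) :=
  inferInstanceAs (Algebra K ((B ⊗[K] B) ⧸ freeCommHopfIdeal K B))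

namespace FreeCommHopf

open WithConv

/-- The quotient map `B ⊗ B → L(B)`. -/
noncomputable def mkHom : B ⊗[K] B →ₐ[K] FreeCommHopf K B :=
  Ideal.Quotient.mkₐ K (freeCommHopfIdeal K B)

/-- The canonical algebra map `B → L(B)`. -/
noncomputable def inclHom : B →ₐ[K] FreeCommHopf K B :=
  (mkHom K B).comp Algebra.TensorProduct.includeLeft

/-- The algebra map `B → L(B)` onto the formal antipodes, `b ↦ S b`. -/
noncomputable def antiHom : B →ₐ[K] FreeCommHopf K B :=
  (mkHom K B).comp Algebra.TensorProduct.includeRight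

variable {K B}

theorem hom_ext {A : Type*} [CommRing A] [Algebra K A] {f g : FreeCommHopf K B →ₐ[K] A}
    (h₁ : f.comp (inclHom K B) = g.comp (inclHom K B))
    (h₂ : f.comp (antiHom K B) = g.comp (antiHom K B)) : f = g := by
  have h : f.comp (mkHom K B) = g.comp (mkHom K B) := Algebra.TensorProduct.ext' fun y z => by
    have e : y ⊗ₜ[K] z = (y ⊗ₜ[K] 1) * (1 ⊗ₜ[K] z) := by simp
    rw [e, map_mul, map_mul]
    exact congrArg₂ (· * ·) (AlgHom.congr_fun h₁ y) (AlgHom.congr_fun h₂ z)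
  refine AlgHom.ext fun y => ?_
  obtain ⟨p, rfl⟩ := Ideal.Quotient.mkₐ_surjective K (freeCommHopfIdeal K B) y
  exact AlgHom.congr_fun h p

theorem convMul_eq_lift {A : Type*} [CommRing A] [Algebra K A] (f g : B →ₐ[K] A) (y : B) :
    (toConv f * toConv g) y =
      Algebra.TensorProduct.lift f g (fun _ _ => .all _ _) (Coalgebra.comul (R := K) y) :=
  AlgHom.convMul_apply _ _ _

theorem convMul_eq_lift_comm {A : Type*} [CommRing A] [Algebra K A] (f g : B →ₐ[K] A) (y : B) :
    (toConv g * toConv f) y = Algebra.TensorProduct.lift f g (fun _ _ => .all _ _)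
      (TensorProduct.comm K B B (Coalgebra.comul (R := K) y)) := by
  rw [convMul_eq_lift]
  have h : Algebra.TensorProduct.lift g f (fun _ _ => .all _ _) =
      (Algebra.TensorProduct.lift f g (fun _ _ => .all _ _)).comp
        (Algebra.TensorProduct.comm K B B).toAlgHom :=
    Algebra.TensorProduct.ext' fun y z => by simp [mul_comm]
  exact AlgHom.congr_fun h _

theorem lift_mkHom (y : B ⊗[K] B) :
    Algebra.TensorProduct.lift (inclHom K B) (antiHom K B) (fun _ _ => .all _ _) y =
      mkHom K B y := by
  have h : Algebra.TensorProduct.lift (inclHom K B) (antiHom K B) (fun _ _ => .all _ _) =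
      mkHom K B :=
    Algebra.TensorProduct.ext' fun y z => by
      simp [inclHom, antiHom, ← map_mul]
  rw [h]

theorem incl_mul_anti : toConv (inclHom K B) * toConv (antiHom K B) = 1 := by
  ext y
  rw [convMul_eq_lift, lift_mkHom, AlgHom.convOne_apply, ← AlgHom.commutes (mkHom K B)]
  exact Ideal.Quotient.eq.mpr (Ideal.subset_span (Or.inl ⟨y, rfl⟩))

theorem anti_mul_incl : toConv (antiHom K B) * toConv (inclHom K B) = 1 := by
  ext y
  rw [convMul_eq_lift_comm, lift_mkHom, AlgHom.convOne_apply, ← AlgHom.commutes (mkHom K B)]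
  exact Ideal.Quotient.eq.mpr (Ideal.subset_span (Or.inr ⟨y, rfl⟩))

/-- The algebra map `L(B) → A` given by mutually convolution-inverse algebra maps `B → A`. -/
noncomputable def liftHom {A : Type*} [CommRing A] [Algebra K A] (f g : B →ₐ[K] A)
    (hfg : toConv f * toConv g = 1) (hgf : toConv g * toConv f = 1) :
    FreeCommHopf K B →ₐ[K] A :=
  Ideal.Quotient.liftₐ (freeCommHopfIdeal K B)
    (Algebra.TensorProduct.lift f g (fun _ _ => .all _ _)) (by
      intro p hp
      have h2 : freeCommHopfIdeal K B ≤ RingHom.ker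
          (Algebra.TensorProduct.lift f g (fun _ _ => .all _ _)) := by
        refine Ideal.span_le.mpr ?_
        rintro _ (⟨y, rfl⟩ | ⟨y, rfl⟩)
        · rw [SetLike.mem_coe, RingHom.mem_ker, map_sub, ← convMul_eq_lift, hfg,
            AlgHom.convOne_apply, AlgHom.commutes, sub_self]
        · rw [SetLike.mem_coe, RingHom.mem_ker, map_sub, ← convMul_eq_lift_comm, hgf,
            AlgHom.convOne_apply, AlgHom.commutes, sub_self]
      exact h2 hp)

theorem liftHom_comp_incl {A : Type*} [CommRing A] [Algebra K A] (f g : B →ₐ[K] A)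
    (hfg : toConv f * toConv g = 1) (hgf : toConv g * toConv f = 1) :
    (liftHom f g hfg hgf).comp (inclHom K B) = f := by
  ext y
  have : liftHom f g hfg hgf (inclHom K B y) =
    Algebra.TensorProduct.lift f g (fun _ _ => .all _ _) (y ⊗ₜ[K] 1) := rfl
  simp [this]

theorem liftHom_comp_anti {A : Type*} [CommRing A] [Algebra K A] (f g : B →ₐ[K] A)
    (hfg : toConv f * toConv g = 1) (hgf : toConv g * toConv f = 1) :
    (liftHom f g hfg hgf).comp (antiHom K B) = g := by
  ext y
  have : liftHom f g hfg hgf (antiHom K B y) =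
    Algebra.TensorProduct.lift f g (fun _ _ => .all _ _) (1 ⊗ₜ[K] y) := rfl
  simp [this]

theorem comp_convMul {A A₂ : Type*} [CommRing A] [Algebra K A] [CommRing A₂] [Algebra K A₂]
    (h : A →ₐ[K] A₂) (f g : WithConv (B →ₐ[K] A)) :
    toConv (h.comp (f * g).ofConv) = toConv (h.comp f.ofConv) * toConv (h.comp g.ofConv) := by
  rw [AlgHom.comp_convMul_distrib]

theorem comp_convOne {A A₂ : Type*} [CommRing A] [Algebra K A] [CommRing A₂] [Algebra K A₂]
    (h : A →ₐ[K] A₂) :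
    toConv (h.comp (1 : WithConv (B →ₐ[K] A)).ofConv) = 1 := by
  ext y
  exact AlgHom.commutes h _

theorem comp_incl_mul_anti {A : Type*} [CommRing A] [Algebra K A] (h : FreeCommHopf K B →ₐ[K] A) :
    toConv (h.comp (inclHom K B)) * toConv (h.comp (antiHom K B)) = 1 := by
  rw [← comp_convOne h, ← incl_mul_anti, comp_convMul]

theorem comp_anti_mul_incl {A : Type*} [CommRing A] [Algebra K A] (h : FreeCommHopf K B →ₐ[K] A) :
    toConv (h.comp (antiHom K B)) * toConv (h.comp (inclHom K B)) = 1 := by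
  rw [← comp_convOne h, ← anti_mul_incl, comp_convMul]

theorem conv_incl_mul_anti {A : Type*} [CommRing A] [Algebra K A]
    (h₁ h₂ : FreeCommHopf K B →ₐ[K] A) :
    toConv (toConv (h₁.comp (inclHom K B)) * toConv (h₂.comp (inclHom K B))).ofConv *
      toConv (toConv (h₂.comp (antiHom K B)) * toConv (h₁.comp (antiHom K B))).ofConv = 1 := by
  rw [toConv_ofConv, toConv_ofConv, mul_assoc, ← mul_assoc (toConv (h₂.comp (inclHom K B))),
    comp_incl_mul_anti, one_mul, comp_incl_mul_anti]

theorem conv_anti_mul_incl {A : Type*} [CommRing A] [Algebra K A]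
    (h₁ h₂ : FreeCommHopf K B →ₐ[K] A) :
    toConv (toConv (h₂.comp (antiHom K B)) * toConv (h₁.comp (antiHom K B))).ofConv *
      toConv (toConv (h₁.comp (inclHom K B)) * toConv (h₂.comp (inclHom K B))).ofConv = 1 := by
  rw [toConv_ofConv, toConv_ofConv, mul_assoc, ← mul_assoc (toConv (h₁.comp (antiHom K B))),
    comp_anti_mul_incl, one_mul, comp_anti_mul_incl]

/-- The convolution product of two algebra maps on `L(B)`: `b ↦ ∑ h₁(b₁) h₂(b₂)` and
`S b ↦ ∑ h₂(S b₁) h₁(S b₂)`. -/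
noncomputable def mulHom {A : Type*} [CommRing A] [Algebra K A] (h₁ h₂ : FreeCommHopf K B →ₐ[K] A) :
    FreeCommHopf K B →ₐ[K] A :=
  liftHom (toConv (h₁.comp (inclHom K B)) * toConv (h₂.comp (inclHom K B))).ofConv
    (toConv (h₂.comp (antiHom K B)) * toConv (h₁.comp (antiHom K B))).ofConv
    (conv_incl_mul_anti h₁ h₂) (conv_anti_mul_incl h₁ h₂)

theorem mulHom_comp_incl {A : Type*} [CommRing A] [Algebra K A]
    (h₁ h₂ : FreeCommHopf K B →ₐ[K] A) : (mulHom h₁ h₂).comp (inclHom K B) =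
      (toConv (h₁.comp (inclHom K B)) * toConv (h₂.comp (inclHom K B))).ofConv :=
  liftHom_comp_incl _ _ _ _

theorem mulHom_comp_anti {A : Type*} [CommRing A] [Algebra K A]
    (h₁ h₂ : FreeCommHopf K B →ₐ[K] A) : (mulHom h₁ h₂).comp (antiHom K B) =
      (toConv (h₂.comp (antiHom K B)) * toConv (h₁.comp (antiHom K B))).ofConv :=
  liftHom_comp_anti _ _ _ _

variable (K B)

/-- The comultiplication of `L(B)`: `Δ(b) = ∑ b₁ ⊗ b₂` and `Δ(S b) = ∑ S b₂ ⊗ S b₁`. -/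
noncomputable def comulHom : FreeCommHopf K B →ₐ[K] FreeCommHopf K B ⊗[K] FreeCommHopf K B :=
  mulHom Algebra.TensorProduct.includeLeft Algebra.TensorProduct.includeRight

/-- The counit of `L(B)`: `ε(b) = ε(S b)`, the counit of `b`. -/
noncomputable def counitHom : FreeCommHopf K B →ₐ[K] K :=
  liftHom (1 : WithConv (B →ₐ[K] K)).ofConv (1 : WithConv (B →ₐ[K] K)).ofConv
    (one_mul _) (one_mul _)

/-- The antipode of `L(B)`: it exchanges `b` and `S b`. -/
noncomputable def antipodeHom : FreeCommHopf K B →ₐ[K] FreeCommHopf K B :=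
  liftHom (antiHom K B) (inclHom K B) anti_mul_incl incl_mul_anti

variable {K B}

theorem comp_comul_incl {A : Type*} [CommRing A] [Algebra K A]
    (h : FreeCommHopf K B ⊗[K] FreeCommHopf K B →ₐ[K] A) :
    toConv ((h.comp (comulHom K B)).comp (inclHom K B)) =
      toConv ((h.comp Algebra.TensorProduct.includeLeft).comp (inclHom K B)) *
        toConv ((h.comp Algebra.TensorProduct.includeRight).comp (inclHom K B)) := by
  rw [AlgHom.comp_assoc, comulHom, mulHom_comp_incl, comp_convMul]
  rfl

theorem comp_comul_anti {A : Type*} [CommRing A] [Algebra K A]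
    (h : FreeCommHopf K B ⊗[K] FreeCommHopf K B →ₐ[K] A) :
    toConv ((h.comp (comulHom K B)).comp (antiHom K B)) =
      toConv ((h.comp Algebra.TensorProduct.includeRight).comp (antiHom K B)) *
        toConv ((h.comp Algebra.TensorProduct.includeLeft).comp (antiHom K B)) := by
  rw [AlgHom.comp_assoc, comulHom, mulHom_comp_anti, comp_convMul]
  rfl

/-- An algebra map on `L(B)` that restricts to the counit on `b` and on `S b` is the counit. -/
theorem eq_ofId_comp_counitHom {A : Type*} [CommRing A] [Algebra K A]
    {f : FreeCommHopf K B →ₐ[K] A} (h₁ : toConv (f.comp (inclHom K B)) = 1)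
    (h₂ : toConv (f.comp (antiHom K B)) = 1) : f = (Algebra.ofId K A).comp (counitHom K B) := by
  refine hom_ext ?_ ?_
  · rw [AlgHom.comp_assoc, counitHom, liftHom_comp_incl]
    exact congrArg ofConv h₁
  · rw [AlgHom.comp_assoc, counitHom, liftHom_comp_anti]
    exact congrArg ofConv h₂

theorem conv_assoc {A : Type*} [CommRing A] [Algebra K A] (f g h : WithConv (B →ₐ[K] A)) :
    f * g * h = f * (g * h) := mul_assoc f g h

theorem coassoc_aux :
    (Algebra.TensorProduct.assoc K K K (FreeCommHopf K B) (FreeCommHopf K B)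
      (FreeCommHopf K B)).toAlgHom.comp
      ((Algebra.TensorProduct.map (comulHom K B) (.id K (FreeCommHopf K B))).comp (comulHom K B))
      = (Algebra.TensorProduct.map (.id K (FreeCommHopf K B)) (comulHom K B)).comp
        (comulHom K B) := by
  have e₁ : ((Algebra.TensorProduct.assoc K K K (FreeCommHopf K B) (FreeCommHopf K B)
      (FreeCommHopf K B)).toAlgHom.comp (Algebra.TensorProduct.map (comulHom K B)
      (.id K (FreeCommHopf K B)))).comp Algebra.TensorProduct.includeLeft =
      ((Algebra.TensorProduct.assoc K K K (FreeCommHopf K B) (FreeCommHopf K B)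
      (FreeCommHopf K B)).toAlgHom.comp Algebra.TensorProduct.includeLeft).comp (comulHom K B) := by
    ext y; simp
  have e₂ : (Algebra.TensorProduct.map (.id K (FreeCommHopf K B)) (comulHom K B)).comp
      Algebra.TensorProduct.includeRight =
      Algebra.TensorProduct.includeRight.comp (comulHom K B) := by
    ext y; simp
  have e₃ : ((Algebra.TensorProduct.assoc K K K (FreeCommHopf K B) (FreeCommHopf K B)
      (FreeCommHopf K B)).toAlgHom.comp Algebra.TensorProduct.includeLeft).comp
        Algebra.TensorProduct.includeLeft =
      (Algebra.TensorProduct.map (.id K (FreeCommHopf K B)) (comulHom K B)).comp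
        Algebra.TensorProduct.includeLeft := by
    ext y; simp [Algebra.TensorProduct.one_def]
  have e₄ : ((Algebra.TensorProduct.assoc K K K (FreeCommHopf K B) (FreeCommHopf K B)
      (FreeCommHopf K B)).toAlgHom.comp Algebra.TensorProduct.includeLeft).comp
        Algebra.TensorProduct.includeRight =
      Algebra.TensorProduct.includeRight.comp Algebra.TensorProduct.includeLeft := by
    ext y; simp
  have e₅ : ((Algebra.TensorProduct.assoc K K K (FreeCommHopf K B) (FreeCommHopf K B)
      (FreeCommHopf K B)).toAlgHom.comp (Algebra.TensorProduct.map (comulHom K B)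
      (.id K (FreeCommHopf K B)))).comp Algebra.TensorProduct.includeRight =
      Algebra.TensorProduct.includeRight.comp Algebra.TensorProduct.includeRight := by
    ext y; simp [Algebra.TensorProduct.one_def]
  rw [← AlgHom.comp_assoc]
  refine hom_ext (toConv_injective ?_) (toConv_injective ?_)
  · rw [comp_comul_incl, comp_comul_incl, e₁, e₂, comp_comul_incl, comp_comul_incl, e₃, e₄, e₅]
    exact conv_assoc _ _ _
  · rw [comp_comul_anti, comp_comul_anti, e₁, e₂, comp_comul_anti, comp_comul_anti, e₃, e₄, e₅]
    exact (conv_assoc _ _ _).symm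

theorem rTensor_aux : (Algebra.TensorProduct.map (counitHom K B)
    (.id K (FreeCommHopf K B))).comp (comulHom K B) =
      (Algebra.TensorProduct.lid K (FreeCommHopf K B)).symm.toAlgHom := by
  have e₁ : (Algebra.TensorProduct.map (counitHom K B) (.id K (FreeCommHopf K B))).comp
      Algebra.TensorProduct.includeLeft =
      (Algebra.ofId K (K ⊗[K] FreeCommHopf K B)).comp (counitHom K B) := by
    ext y; simp [Algebra.ofId_apply, Algebra.TensorProduct.algebraMap_apply]
  have e₂ : (Algebra.TensorProduct.map (counitHom K B) (.id K (FreeCommHopf K B))).comp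
      Algebra.TensorProduct.includeRight =
      (Algebra.TensorProduct.lid K (FreeCommHopf K B)).symm.toAlgHom := by
    ext y; simp
  have u₁ : toConv (((Algebra.ofId K (K ⊗[K] FreeCommHopf K B)).comp (counitHom K B)).comp
      (inclHom K B)) = 1 := by
    rw [AlgHom.comp_assoc, counitHom, liftHom_comp_incl, comp_convOne]
  have u₂ : toConv (((Algebra.ofId K (K ⊗[K] FreeCommHopf K B)).comp (counitHom K B)).comp
      (antiHom K B)) = 1 := by
    rw [AlgHom.comp_assoc, counitHom, liftHom_comp_anti, comp_convOne]
  refine hom_ext (toConv_injective ?_) (toConv_injective ?_)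
  · rw [comp_comul_incl, e₁, e₂, u₁, one_mul]
  · rw [comp_comul_anti, e₁, e₂, u₂, mul_one]

theorem lTensor_aux : (Algebra.TensorProduct.map (.id K (FreeCommHopf K B))
    (counitHom K B)).comp (comulHom K B) =
      (Algebra.TensorProduct.rid K K (FreeCommHopf K B)).symm.toAlgHom := by
  have e₁ : (Algebra.TensorProduct.map (.id K (FreeCommHopf K B)) (counitHom K B)).comp
      Algebra.TensorProduct.includeRight =
      (Algebra.ofId K (FreeCommHopf K B ⊗[K] K)).comp (counitHom K B) := by
    ext y
    simp only [AlgHom.comp_apply, Algebra.TensorProduct.includeRight_apply,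
      Algebra.TensorProduct.map_tmul, map_one, Algebra.ofId_apply,
      Algebra.algebraMap_eq_smul_one, Algebra.TensorProduct.one_def, ← TensorProduct.tmul_smul,
      smul_eq_mul, mul_one]
  have e₂ : (Algebra.TensorProduct.map (.id K (FreeCommHopf K B)) (counitHom K B)).comp
      Algebra.TensorProduct.includeLeft =
      (Algebra.TensorProduct.rid K K (FreeCommHopf K B)).symm.toAlgHom := by
    ext y; simp
  have u₁ : toConv (((Algebra.ofId K (FreeCommHopf K B ⊗[K] K)).comp (counitHom K B)).comp
      (inclHom K B)) = 1 := by
    rw [AlgHom.comp_assoc, counitHom, liftHom_comp_incl, comp_convOne]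
  have u₂ : toConv (((Algebra.ofId K (FreeCommHopf K B ⊗[K] K)).comp (counitHom K B)).comp
      (antiHom K B)) = 1 := by
    rw [AlgHom.comp_assoc, counitHom, liftHom_comp_anti, comp_convOne]
  refine hom_ext (toConv_injective ?_) (toConv_injective ?_)
  · rw [comp_comul_incl, e₁, e₂, u₁, mul_one]
  · rw [comp_comul_anti, e₁, e₂, u₂, one_mul]

noncomputable instance : Bialgebra K (FreeCommHopf K B) :=
  Bialgebra.ofAlgHom (comulHom K B) (counitHom K B) coassoc_aux rTensor_aux lTensor_aux

theorem lift_includeLeft {A A₂ : Type*} [CommRing A] [Algebra K A] [CommRing A₂] [Algebra K A₂]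
    (f g : A →ₐ[K] A₂) : (Algebra.TensorProduct.lift f g fun _ _ => .all _ _).comp
      (Algebra.TensorProduct.includeLeft : A →ₐ[K] A ⊗[K] A) = f := by
  ext y; simp

theorem lift_includeRight {A A₂ : Type*} [CommRing A] [Algebra K A] [CommRing A₂] [Algebra K A₂]
    (f g : A →ₐ[K] A₂) : (Algebra.TensorProduct.lift f g fun _ _ => .all _ _).comp
      (Algebra.TensorProduct.includeRight : A →ₐ[K] A ⊗[K] A) = g := by
  ext y; simp

theorem antipode_incl : (antipodeHom K B).comp (inclHom K B) = antiHom K B :=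
  liftHom_comp_incl _ _ _ _

theorem antipode_anti : (antipodeHom K B).comp (antiHom K B) = inclHom K B :=
  liftHom_comp_anti _ _ _ _

noncomputable instance : HopfAlgebra K (FreeCommHopf K B) :=
  HopfAlgebra.ofAlgHom (antipodeHom K B)
    (eq_ofId_comp_counitHom
      (by
        change toConv (((Algebra.TensorProduct.lift (antipodeHom K B) (.id K (FreeCommHopf K B))
          fun _ _ => .all _ _).comp (comulHom K B)).comp (inclHom K B)) = 1
        rw [comp_comul_incl, lift_includeLeft,
          lift_includeRight, antipode_incl, AlgHom.id_comp,
          anti_mul_incl])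
      (by
        change toConv (((Algebra.TensorProduct.lift (antipodeHom K B) (.id K (FreeCommHopf K B))
          fun _ _ => .all _ _).comp (comulHom K B)).comp (antiHom K B)) = 1
        rw [comp_comul_anti, lift_includeLeft,
          lift_includeRight, antipode_anti, AlgHom.id_comp,
          anti_mul_incl]))
    (eq_ofId_comp_counitHom
      (by
        change toConv (((Algebra.TensorProduct.lift (.id K (FreeCommHopf K B)) (antipodeHom K B)
          fun _ _ => .all _ _).comp (comulHom K B)).comp (inclHom K B)) = 1
        rw [comp_comul_incl, lift_includeLeft,
          lift_includeRight, antipode_incl, AlgHom.id_comp,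
          incl_mul_anti])
      (by
        change toConv (((Algebra.TensorProduct.lift (.id K (FreeCommHopf K B)) (antipodeHom K B)
          fun _ _ => .all _ _).comp (comulHom K B)).comp (antiHom K B)) = 1
        rw [comp_comul_anti, lift_includeLeft,
          lift_includeRight, antipode_anti, AlgHom.id_comp,
          incl_mul_anti]))

variable (K B) in
/-- The canonical bialgebra map `B → L(B)`. -/
noncomputable def incl : B →ₐc[K] FreeCommHopf K B :=
  BialgHom.ofAlgHom (inclHom K B)
    (by
      change (counitHom K B).comp (inclHom K B) = _
      rw [counitHom, liftHom_comp_incl]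
      rfl)
    (by
      change _ = (comulHom K B).comp (inclHom K B)
      rw [comulHom, mulHom_comp_incl, AlgHom.convMul_def]
      have h : (Algebra.TensorProduct.map (inclHom K B) (inclHom K B)) =
          (Algebra.TensorProduct.lmul' K).comp (Algebra.TensorProduct.map
            (Algebra.TensorProduct.includeLeft.comp (inclHom K B))
            (Algebra.TensorProduct.includeRight.comp (inclHom K B))) :=
        Algebra.TensorProduct.ext' fun y z => by simp
      rw [h]
      rfl)

end FreeCommHopf

end FreeCommHopf

/-! ### The universal coacting Hopf algebra `H(a)` -/

section UniversalHopf

variable {K : Type u} [Field K] {P : SymmOperad.{u, w} K} {a : Type v} [AddCommGroup a]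
  [Module K a] {n : ℕ}

/-- The Hopf algebra `H(a) = L(C(a))`. -/
abbrev UniversalHopf (γ : OperadAlgebra P a) (b : Module.Basis (Fin n) K a) : Type u :=
  FreeCommHopf K (UniversalAlgebra γ b)

/-- The map `λ_a = (id ⊗ μ) ∘ η_a : a → a ⊗ H(a)`, where `μ : C(a) → L(C(a))` is canonical. -/
noncomputable def universalCoaction (γ : OperadAlgebra P a) (b : Module.Basis (Fin n) K a) :
    a →ₗ[K] a ⊗[K] UniversalHopf γ b :=
  (FreeCommHopf.incl K (UniversalAlgebra γ b) :
    UniversalAlgebra γ b →ₗ[K] UniversalHopf γ b).lTensor a ∘ₗ UniversalAlgebra.eta γ b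

end UniversalHopf

end OperadCoaction

/-!
The theorem combines two universal properties.

*Coactions are matrices.* In the basis `b`, a linear map `ψ : a → a ⊗ C` is a matrix `c` over `C`,
through `ψ (b i) = ∑ s, b s ⊗ c s i`. Comparing coordinates, `ψ` is a morphism of `P`-algebras
exactly when `c` satisfies the relations defining `C(a)`, and it is a comodule structure exactly
when `Δ (c s t) = ∑ i, c s i ⊗ c i t` and `ε (c s t) = δ_{st}` (`isCoaction_iff`). Hence coactions
of `H` correspond to bialgebra maps `C(a) → H` (`UniversalAlgebra.existsUnique_bialgHom`). The
matrix of `λ_a` is the image of the universal matrix `(x_{st})` under a bialgebra map, so `λ_a` is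
a coaction.

*`L(B)` is the free commutative Hopf algebra on `B`.* For a commutative algebra `A`, the algebra
maps `B → A` form a monoid under convolution, and an algebra map `L(B) → A` is an algebra map
`B → A` together with a two-sided convolution inverse. Inverses in a monoid are unique, so a map on
`L(B)` is determined by its restriction to `B` (`FreeCommHopf.hom_ext_of_comp_inclHom`). If `H` is
a commutative Hopf algebra with antipode `S`, then `S ∘ f` is a convolution inverse of
`f : B → H`, which gives the extension of `f` to `L(B)`; since it suffices to check compatibility
with `Δ` and `ε` on `B`, the extension is a bialgebra map.

Hopf algebra maps are encoded as bialgebra maps, as these commute with the antipodes automatically.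
-/

namespace OperadCoaction

/-! ### The universal property of `L(B)` -/

namespace FreeCommHopf

open WithConv

variable {K : Type u} [Field K] {B : Type v} [CommRing B] [Bialgebra K B]

/-- Algebra maps on `L(B)` agree if they agree on `B`: their values on the formal antipodes are
convolution inverses of their restrictions to `B`. -/
theorem hom_ext_of_comp_inclHom {A : Type*} [CommRing A] [Algebra K A]
    {f g : FreeCommHopf K B →ₐ[K] A}
    (h : f.comp (inclHom K B) = g.comp (inclHom K B)) : f = g := by
  refine hom_ext h (toConv_injective (left_inv_eq_right_inv (comp_anti_mul_incl f) ?_))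
  rw [h]
  exact comp_incl_mul_anti g

theorem coe_incl : (incl K B : B →ₐ[K] FreeCommHopf K B) = inclHom K B := rfl

theorem bialgHom_ext {H : Type*} [CommRing H] [Bialgebra K H] {f g : FreeCommHopf K B →ₐc[K] H}
    (h : f.comp (incl K B) = g.comp (incl K B)) : f = g := by
  have e : (f : FreeCommHopf K B →ₐ[K] H) = g :=
    hom_ext_of_comp_inclHom (AlgHom.ext fun y => DFunLike.congr_fun h y)
  exact BialgHom.ext fun y => AlgHom.congr_fun e y

section Lift

variable {H : Type x} [CommRing H] [HopfAlgebra K H]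

theorem toConv_mul_antipode_comp (f : B →ₐc[K] H) :
    toConv (f : B →ₐ[K] H) * toConv ((HopfAlgebra.antipodeAlgHom K H).comp (f : B →ₐ[K] H)) =
      1 := by
  have h : toConv (AlgHom.id K H) * toConv (HopfAlgebra.antipodeAlgHom K H) = 1 :=
    mul_inv_cancel (toConv (AlgHom.id K H))
  have e := AlgHom.convMul_comp_bialgHom_distrib (toConv (AlgHom.id K H))
    (toConv (HopfAlgebra.antipodeAlgHom K H)) f
  rw [h] at e
  refine ofConv_injective (e.symm.trans ?_)
  ext y
  simp

theorem toConv_antipode_comp_mul (f : B →ₐc[K] H) :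
    toConv ((HopfAlgebra.antipodeAlgHom K H).comp (f : B →ₐ[K] H)) * toConv (f : B →ₐ[K] H) =
      1 := by
  have h : toConv (HopfAlgebra.antipodeAlgHom K H) * toConv (AlgHom.id K H) = 1 :=
    inv_mul_cancel (toConv (AlgHom.id K H))
  have e := AlgHom.convMul_comp_bialgHom_distrib (toConv (HopfAlgebra.antipodeAlgHom K H))
    (toConv (AlgHom.id K H)) f
  rw [h] at e
  refine ofConv_injective (e.symm.trans ?_)
  ext y
  simp

/-- The algebra map `L(B) → H` extending the bialgebra map `f : B → H`, given on the formal
antipodes by `S b ↦ S (f b)`. -/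
noncomputable def liftAlgHom (f : B →ₐc[K] H) : FreeCommHopf K B →ₐ[K] H :=
  liftHom (f : B →ₐ[K] H) ((HopfAlgebra.antipodeAlgHom K H).comp (f : B →ₐ[K] H))
    (toConv_mul_antipode_comp f) (toConv_antipode_comp_mul f)

theorem liftAlgHom_comp_inclHom (f : B →ₐc[K] H) :
    (liftAlgHom f).comp (inclHom K B) = (f : B →ₐ[K] H) :=
  liftHom_comp_incl _ _ _ _

/-- The bialgebra map `L(B) → H` extending the bialgebra map `f : B → H`. -/
noncomputable def lift (f : B →ₐc[K] H) : FreeCommHopf K B →ₐc[K] H :=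
  BialgHom.ofAlgHom (liftAlgHom f)
    (hom_ext_of_comp_inclHom (by
      rw [AlgHom.comp_assoc, liftAlgHom_comp_inclHom, BialgHom.counitAlgHom_comp, ← coe_incl,
        BialgHom.counitAlgHom_comp]))
    (hom_ext_of_comp_inclHom (by
      rw [AlgHom.comp_assoc, AlgHom.comp_assoc, liftAlgHom_comp_inclHom, ← coe_incl,
        ← BialgHom.map_comp_comulAlgHom, ← BialgHom.map_comp_comulAlgHom, ← AlgHom.comp_assoc,
        ← Algebra.TensorProduct.map_comp, coe_incl, liftAlgHom_comp_inclHom]))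

theorem lift_comp_incl (f : B →ₐc[K] H) : (lift f).comp (incl K B) = f :=
  BialgHom.ext fun y => AlgHom.congr_fun (liftAlgHom_comp_inclHom f) y

theorem existsUnique_comp_incl (f : B →ₐc[K] H) :
    ∃! g : FreeCommHopf K B →ₐc[K] H, g.comp (incl K B) = f :=
  ⟨lift f, lift_comp_incl f, fun _ hg => bialgHom_ext (hg.trans (lift_comp_incl f).symm)⟩

end Lift

end FreeCommHopf

/-! ### Coactions in coordinates -/

section Coordinates

variable {K : Type u} [Field K] {P : SymmOperad.{u, w} K} {a : Type v} [AddCommGroup a]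
  [Module K a] {n : ℕ} (b : Module.Basis (Fin n) K a)

theorem exists_sum_basis_tmul {M : Type*} [AddCommGroup M] [Module K M] (z : a ⊗[K] M) :
    ∃ m : Fin n → M, z = ∑ s, b s ⊗ₜ[K] m s := by
  refine ⟨TensorProduct.equivFinsuppOfBasisLeft b z, ?_⟩
  conv_lhs => rw [← (TensorProduct.equivFinsuppOfBasisLeft b).symm_apply_apply z]
  rw [TensorProduct.equivFinsuppOfBasisLeft_symm_apply, Finsupp.sum_fintype _ _ (by simp)]

theorem sum_basis_tmul_inj {M : Type*} [AddCommGroup M] [Module K M] {m m' : Fin n → M} :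
    ∑ s, b s ⊗ₜ[K] m s = ∑ s, b s ⊗ₜ[K] m' s ↔ ∀ s, m s = m' s := by
  refine ⟨fun h s => ?_, fun h => by simp [h]⟩
  have e := DFunLike.congr_fun (congrArg (TensorProduct.equivFinsuppOfBasisLeft b) h) s
  simpa [TensorProduct.equivFinsuppOfBasisLeft_apply_tmul_apply, Finsupp.single_apply,
    ite_smul] using e

variable {b}

/-- A linear map `a → a ⊗ C` is a morphism of `P`-algebras if and only if its matrix satisfies the
relations that define `C(a)`. -/
theorem isAlgebraHom_iff_relations {C : Type*} [CommRing C] [Algebra K C]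
    (γ : OperadAlgebra P a) {ψ : a →ₗ[K] a ⊗[K] C} {c : Fin n → Fin n → C}
    (hc : ∀ i, ψ (b i) = ∑ s, b s ⊗ₜ[K] c s i) :
    IsAlgebraHom γ (tensorStructure C γ) ψ ↔ UniversalAlgebra.Relations γ b c := by
  have hop : ∀ (k : ℕ) (μ : P.Op k) (i : Fin k → Fin n),
      γ.operation μ (fun j => b (i j)) = ∑ u, structConst γ b μ i u • b u := fun k μ i =>
    (b.sum_repr _).symm
  have hl : ∀ (k : ℕ) (μ : P.Op k) (i : Fin k → Fin n), ψ (γ.operation μ fun j => b (i j)) =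
      ∑ s, b s ⊗ₜ[K] ∑ u, algebraMap K C (structConst γ b μ i u) * c s u := fun k μ i => by
    simp only [hop, map_sum, map_smul, hc, Finset.smul_sum, TensorProduct.tmul_sum,
      ← Algebra.smul_def, TensorProduct.tmul_smul]
    exact Finset.sum_comm
  have hr : ∀ (k : ℕ) (μ : P.Op k) (i : Fin k → Fin n),
      (tensorStructure C γ).operation μ (fun j => ψ (b (i j))) =
        ∑ s, b s ⊗ₜ[K] ∑ t : Fin k → Fin n,
          algebraMap K C (structConst γ b μ t s) * ∏ j, c (t j) (i j) := fun k μ i => by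
    simp only [hc, MultilinearMap.map_sum, tensorStructure_operation_tmul, hop,
      TensorProduct.sum_tmul, TensorProduct.tmul_sum, ← Algebra.smul_def,
      TensorProduct.tmul_smul, TensorProduct.smul_tmul']
    exact Finset.sum_comm
  refine ⟨fun h k μ i => (sum_basis_tmul_inj b).mp ?_, fun h k μ => ?_⟩
  · rw [← hl, ← hr]
    exact h k μ _
  · have e : ψ.compMultilinearMap (γ.operation μ) =
        ((tensorStructure C γ).operation μ).compLinearMap fun _ => ψ :=
      Module.Basis.ext_multilinear (fun _ => b) fun i =>
        (hl k μ i).trans (((sum_basis_tmul_inj b).mpr (h k μ i)).trans (hr k μ i).symm)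
    exact fun y => DFunLike.congr_fun e y

theorem coassoc_iff {C : Type*} [AddCommGroup C] [Module K C] [Coalgebra K C]
    {ψ : a →ₗ[K] a ⊗[K] C} {c : Fin n → Fin n → C}
    (hc : ∀ i, ψ (b i) = ∑ s, b s ⊗ₜ[K] c s i) :
    (Coalgebra.comul (R := K) (A := C)).lTensor a ∘ₗ ψ =
        (TensorProduct.assoc K a C C).toLinearMap ∘ₗ ψ.rTensor C ∘ₗ ψ ↔
      ∀ s t, Coalgebra.comul (R := K) (c s t) = ∑ i, c s i ⊗ₜ[K] c i t := by
  have hr : ∀ t, ((TensorProduct.assoc K a C C).toLinearMap ∘ₗ ψ.rTensor C ∘ₗ ψ) (b t) =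
      ∑ s, b s ⊗ₜ[K] ∑ i, c s i ⊗ₜ[K] c i t := fun t => by
    simp only [LinearMap.comp_apply, hc, map_sum, LinearMap.rTensor_tmul, TensorProduct.sum_tmul,
      LinearEquiv.coe_coe, TensorProduct.assoc_tmul, TensorProduct.tmul_sum]
    exact Finset.sum_comm
  have hl : ∀ t, ((Coalgebra.comul (R := K) (A := C)).lTensor a ∘ₗ ψ) (b t) =
      ∑ s, b s ⊗ₜ[K] Coalgebra.comul (R := K) (c s t) := fun t => by simp [hc]
  rw [forall_comm]
  refine ⟨fun h t => (sum_basis_tmul_inj b).mp ?_, fun h => b.ext fun t => ?_⟩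
  · rw [← hl, ← hr, h]
  · rw [hl, hr]
    exact (sum_basis_tmul_inj b).mpr (h t)

theorem counit_iff {C : Type*} [AddCommGroup C] [Module K C] [Coalgebra K C]
    {ψ : a →ₗ[K] a ⊗[K] C} {c : Fin n → Fin n → C}
    (hc : ∀ i, ψ (b i) = ∑ s, b s ⊗ₜ[K] c s i) :
    (Coalgebra.counit (R := K) (A := C)).lTensor a ∘ₗ ψ =
        (TensorProduct.rid K a).symm.toLinearMap ↔
      ∀ s t, Coalgebra.counit (R := K) (c s t) = if s = t then 1 else 0 := by
  have hr : ∀ t, (TensorProduct.rid K a).symm.toLinearMap (b t) =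
      ∑ s, b s ⊗ₜ[K] (if s = t then (1 : K) else 0) := fun t => by
    simp [TensorProduct.tmul_ite]
  have hl : ∀ t, ((Coalgebra.counit (R := K) (A := C)).lTensor a ∘ₗ ψ) (b t) =
      ∑ s, b s ⊗ₜ[K] Coalgebra.counit (R := K) (c s t) := fun t => by simp [hc]
  rw [forall_comm]
  refine ⟨fun h t => (sum_basis_tmul_inj b).mp ?_, fun h => b.ext fun t => ?_⟩
  · rw [← hl, ← hr, h]
  · rw [hl, hr]
    exact (sum_basis_tmul_inj b).mpr (h t)

theorem isCoaction_iff {H : Type x} [CommRing H] [Bialgebra K H] (γ : OperadAlgebra P a)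
    {ψ : a →ₗ[K] a ⊗[K] H} {c : Fin n → Fin n → H}
    (hc : ∀ i, ψ (b i) = ∑ s, b s ⊗ₜ[K] c s i) :
    IsCoaction γ ψ ↔ UniversalAlgebra.Relations γ b c ∧
      (∀ s t, Coalgebra.comul (R := K) (c s t) = ∑ i, c s i ⊗ₜ[K] c i t) ∧
      ∀ s t, Coalgebra.counit (R := K) (c s t) = if s = t then 1 else 0 := by
  rw [← isAlgebraHom_iff_relations γ hc, ← coassoc_iff hc, ← counit_iff hc]
  exact ⟨fun h => ⟨h.1, h.2, h.3⟩, fun h => ⟨h.1, h.2.1, h.2.2⟩⟩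

end Coordinates

/-! ### The universal coactions of `C(a)` and `H(a)` -/

section Universal

variable {K : Type u} [Field K] {P : SymmOperad.{u, w} K} {a : Type v} [AddCommGroup a]
  [Module K a] {n : ℕ} (γ : OperadAlgebra P a) (b : Module.Basis (Fin n) K a)

namespace UniversalAlgebra

theorem comul_gen (s t : Fin n) : Coalgebra.comul (R := K) (gen γ b s t) =
    ∑ i, gen γ b s i ⊗ₜ[K] gen γ b i t := by
  change comulHom γ b (gen γ b s t) = _
  rw [comulHom, liftHom_gen]

theorem counit_gen (s t : Fin n) :
    Coalgebra.counit (R := K) (gen γ b s t) = if s = t then 1 else 0 := by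
  change counitHom γ b (gen γ b s t) = _
  rw [counitHom, liftHom_gen]

theorem eta_basis (i : Fin n) : eta γ b (b i) = ∑ s, b s ⊗ₜ[K] gen γ b s i :=
  b.constr_basis K _ i

variable {γ b} in
theorem bialgHom_ext {H : Type*} [CommRing H] [Bialgebra K H]
    {f g : UniversalAlgebra γ b →ₐc[K] H} (h : ∀ s i, f (gen γ b s i) = g (gen γ b s i)) :
    f = g := by
  have e : (f : UniversalAlgebra γ b →ₐ[K] H) = g := hom_ext h
  exact BialgHom.ext fun y => AlgHom.congr_fun e y

theorem lTensor_eta_basis {H : Type*} [CommRing H] [Bialgebra K H]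
    (f : UniversalAlgebra γ b →ₐc[K] H) (i : Fin n) :
    ((f : UniversalAlgebra γ b →ₗ[K] H).lTensor a ∘ₗ eta γ b) (b i) =
      ∑ s, b s ⊗ₜ[K] f (gen γ b s i) := by
  simp [eta_basis]

theorem isCoaction_lTensor_eta {H : Type x} [CommRing H] [Bialgebra K H]
    (f : UniversalAlgebra γ b →ₐc[K] H) :
    IsCoaction γ ((f : UniversalAlgebra γ b →ₗ[K] H).lTensor a ∘ₗ eta γ b) := by
  refine (isCoaction_iff γ (lTensor_eta_basis γ b f)).mpr ⟨?_, fun s t => ?_, fun s t => ?_⟩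
  · exact (relations_gen γ b).map γ b (f : UniversalAlgebra γ b →ₐ[K] H)
  · rw [← CoalgHomClass.map_comp_comul_apply, comul_gen]
    simp
  · rw [CoalgHomClass.counit_comp_apply, counit_gen]

variable {γ}

/-- `C(a)` is universal among the commutative bialgebras coacting on `a`. -/
theorem existsUnique_bialgHom {H : Type x} [CommRing H] [Bialgebra K H] {ψ : a →ₗ[K] a ⊗[K] H}
    (hψ : IsCoaction γ ψ) :
    ∃! f : UniversalAlgebra γ b →ₐc[K] H,
      (f : UniversalAlgebra γ b →ₗ[K] H).lTensor a ∘ₗ eta γ b = ψ := by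
  choose c hc using fun i => exists_sum_basis_tmul b (ψ (b i))
  -- `choose` lists the entries column by column, hence the transposition.
  obtain ⟨h_rel, h_comul, h_counit⟩ := (isCoaction_iff γ (c := fun s i => c i s) hc).mp hψ
  refine ⟨BialgHom.ofAlgHom (liftHom (fun s i => c i s) h_rel) (hom_ext fun s i => ?_)
    (hom_ext fun s i => ?_), b.ext fun i => ?_, fun g hg => bialgHom_ext fun s i => ?_⟩
  · simp [h_counit, counit_gen]
  · simp [h_comul, comul_gen]
  · simp [lTensor_eta_basis, hc]
  · have e := LinearMap.congr_fun hg (b i)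
    rw [lTensor_eta_basis, hc] at e
    simpa using (sum_basis_tmul_inj b).mp e s

end UniversalAlgebra

theorem lTensor_universalCoaction {H : Type*} [CommRing H] [Bialgebra K H]
    (Φ : UniversalHopf γ b →ₐc[K] H) :
    (Φ : UniversalHopf γ b →ₗ[K] H).lTensor a ∘ₗ universalCoaction γ b =
      (Φ.comp (FreeCommHopf.incl K (UniversalAlgebra γ b)) :
        UniversalAlgebra γ b →ₗ[K] H).lTensor a ∘ₗ UniversalAlgebra.eta γ b := by
  rw [universalCoaction, ← LinearMap.comp_assoc, ← LinearMap.lTensor_comp]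
  rfl

theorem existsUnique_lTensor_universalCoaction {H : Type x} [CommRing H] [HopfAlgebra K H]
    {ψ : a →ₗ[K] a ⊗[K] H} (hψ : IsCoaction γ ψ) :
    ∃! Φ : UniversalHopf γ b →ₐc[K] H,
      (Φ : UniversalHopf γ b →ₗ[K] H).lTensor a ∘ₗ universalCoaction γ b = ψ := by
  simp only [lTensor_universalCoaction]
  obtain ⟨f, hf, hf_unique⟩ := UniversalAlgebra.existsUnique_bialgHom b hψ
  refine ⟨FreeCommHopf.lift f, ?_, fun Φ hΦ => FreeCommHopf.bialgHom_ext ?_⟩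
  · simpa only [FreeCommHopf.lift_comp_incl] using hf
  · rw [FreeCommHopf.lift_comp_incl]
    exact hf_unique _ hΦ

end Universal

end OperadCoaction

theorem mainTheorem3 {K : Type u} [Field K] [CharZero K] {P : OperadCoaction.SymmOperad.{u, w} K}
    {a : Type v} [AddCommGroup a] [Module K a] {n : ℕ} (γ : OperadCoaction.OperadAlgebra P a)
    (b : Module.Basis (Fin n) K a) :
    -- `H(a)` is the free commutative Hopf algebra on the bialgebra `C(a)`
    (∀ (H : Type x) [CommRing H] [HopfAlgebra K H]
      (f : OperadCoaction.UniversalAlgebra γ b →ₐc[K] H),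
      ∃! g : OperadCoaction.UniversalHopf γ b →ₐc[K] H,
        g.comp (OperadCoaction.FreeCommHopf.incl K (OperadCoaction.UniversalAlgebra γ b)) = f) ∧
    -- `λ_a` is a coaction of `H(a)` on `a`
    OperadCoaction.IsCoaction γ (OperadCoaction.universalCoaction γ b) ∧
    -- the universal property of `(H(a), λ_a)`
    (∀ (H : Type x) [CommRing H] [HopfAlgebra K H] (ψ : a →ₗ[K] a ⊗[K] H),
      OperadCoaction.IsCoaction γ ψ →
      ∃! Φ : OperadCoaction.UniversalHopf γ b →ₐc[K] H,
        (Φ : OperadCoaction.UniversalHopf γ b →ₗ[K] H).lTensor a ∘ₗ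
          OperadCoaction.universalCoaction γ b = ψ) := by
  exact ⟨fun H _ _ f => OperadCoaction.FreeCommHopf.existsUnique_comp_incl f,
    OperadCoaction.UniversalAlgebra.isCoaction_lTensor_eta γ b _,
    fun H _ _ ψ hψ => OperadCoaction.existsUnique_lTensor_universalCoaction γ b hψ⟩
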